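/- Conventions. Let $\langle Y;S\rangle$ be a finite presentation of a group $H$. A function $f:\mathbb N\to\mathbb R$ is an isoperimetric function for $\langle Y;S\rangle$ if every (not necessarily reduced) word $w$ of length $n$ in the letters $y^{\pm1}$ ($y\in Y$) that equals $1$ in $H$ is, in the free group on $Y$, a product of at most $f(n)$ conjugates of elements of $S$ and their inverses. The group $H$ has an isoperimetric function that is polynomial of degree $k$ if some finite presentation of $H$ has an isoperimetric function $n\mapsto p(n)$ with $p$ a real polynomial of degree $k$; it has an exponential isoperimetric function if some finite presentation of $H$ has an isoperimetric function $n\mapsto Cb^n$ with $C>0$, $b>1$. Theorem. Let $\Gamma$ be a finite simple graph with a group $G_i$ at each vertex $i$, and let $G$ be the graph product of the $G_i$, i.e. the quotient of the free product of the $G_i$ by the normal closure of all commutators $[g,h]$ with $g\in G_i$, $h\in G_j$ and $i,j$ joined by an edge. (1) Let $k>1$ be an integer. If every $G_i$ is finitely presented and has an isoperimetric function that is polynomial of degree $k$, then so does $G$. (2) If every $G_i$ is finitely presented and has an exponential isoperimetric function, then so does $G$. (3) Let $\langle A_i;R_i\rangle$ be finite presentations of the $G_i$, with the $A_i$ disjoint,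 and let $S$ be the set of commutators $[a,b]$ with $a\in A_i$, $b\in A_j$ and $i,j$ joined by an edge. Then $\langle \bigcup_i A_i;\ \bigcup_i R_i\cup S\rangle$ is a finite presentation of $G$. If $f$ is an isoperimetric function for all the presentations $\langle A_i;R_i\rangle$, then $g(n)+n^2$ is an isoperimetric function for this presentation of $G$, where $g(n)$ is the maximum of $f(n_1)+\cdots+f(n_s)$ over all $s$ and all positive integers $n_1,\dots,n_s$ with $n_1+\cdots+n_s=n$ (so $g(0)=0$). The last assertion also holds if, both in the hypothesis and in the conclusion, the condition defining isoperimetric functions is required only for positive words, i.e. words in the generators without inverses. -/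

import Mathlib

/-- The relators of the graph product inside the free product of the `G i`: all commutators
`[g, h] = g h g⁻¹ h⁻¹` with `g ∈ G i`, `h ∈ G j` and `i`, `j` joined by an edge. -/
def graphProductCommutators {V : Type*} (Γ : SimpleGraph V) (G : V → Type*) [∀ i, Group (G i)] :
    Set (Monoid.CoprodI G) :=
  {x | ∃ i j : V, Γ.Adj i j ∧ ∃ (g : G i) (h : G j),
    x = Monoid.CoprodI.of g * Monoid.CoprodI.of h *
      (Monoid.CoprodI.of g)⁻¹ * (Monoid.CoprodI.of h)⁻¹}

/-- The graph product of the groups `G i` along the graph `Γ`. -/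
abbrev GraphProduct {V : Type*} (Γ : SimpleGraph V) (G : V → Type*) [∀ i, Group (G i)] : Type _ :=
  Monoid.CoprodI G ⧸ Subgroup.normalClosure (graphProductCommutators Γ G)

/-- The canonical homomorphism from a vertex group to the graph product. -/
def GraphProduct.of {V : Type*} (Γ : SimpleGraph V) (G : V → Type*) [∀ i, Group (G i)] (i : V) :
    G i →* GraphProduct Γ G :=
  (QuotientGroup.mk' (Subgroup.normalClosure (graphProductCommutators Γ G))).comp
    Monoid.CoprodI.of

/-- `⟨α; R⟩` is a finite presentation of `H`, where the generator `a : α` stands for `x a`. -/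
structure IsFinitePresentation {α H : Type*} [Group H] (x : α → H) (R : Set (FreeGroup α)) :
    Prop where
  finite_generators : Finite α
  finite_relators : R.Finite
  surjective : Function.Surjective (FreeGroup.lift x)
  ker_eq : (FreeGroup.lift x).ker = Subgroup.normalClosure R

/-- `w` is a product of exactly `m` conjugates of elements of `R` and their inverses. -/
def IsProdOfConjugates {F : Type*} [Group F] (R : Set F) (m : ℕ) (w : F) : Prop :=
  ∃ l : List F, l.length = m ∧ l.prod = w ∧
    ∀ y ∈ l, ∃ r ∈ R, ∃ c : F, y = c * r * c⁻¹ ∨ y = c * r⁻¹ * c⁻¹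

/-- `f` is an isoperimetric function for the presentation `⟨α; R⟩`: every (not necessarily reduced)
word `w` of length `n` in the generators and their inverses that equals `1` in the presented group
is a product of at most `f n` conjugates of relators and their inverses. -/
def IsIsoperimetricFunction {α : Type*} (R : Set (FreeGroup α)) (f : ℕ → ℝ) : Prop :=
  ∀ w : List (α × Bool), PresentedGroup.mk R (FreeGroup.mk w) = 1 →
    ∃ m : ℕ, (m : ℝ) ≤ f w.length ∧ IsProdOfConjugates R m (FreeGroup.mk w)

/-- The same condition, required only for the positive words, i.e. the elements of the free monoid
on the generators. -/
def IsPositiveIsoperimetricFunction {α : Type*} (R : Set (FreeGroup α)) (f : ℕ → ℝ) : Prop :=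
  ∀ w : List α, PresentedGroup.mk R (w.map FreeGroup.of).prod = 1 →
    ∃ m : ℕ, (m : ℝ) ≤ f w.length ∧ IsProdOfConjugates R m (w.map FreeGroup.of).prod

/-- Some finite presentation of `H` has an isoperimetric function which is a (real) polynomial of
degree `k`. -/
def HasPolynomialIsoperimetricFunction (k : ℕ) (H : Type*) [Group H] : Prop :=
  ∃ (m : ℕ) (x : Fin m → H) (R : Set (FreeGroup (Fin m))), IsFinitePresentation x R ∧
    ∃ p : Polynomial ℝ, p.degree = k ∧ IsIsoperimetricFunction R (fun n => p.eval (n : ℝ))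

/-- Some finite presentation of `H` has an isoperimetric function `n ↦ C * b ^ n`. -/
def HasExponentialIsoperimetricFunction (H : Type*) [Group H] : Prop :=
  ∃ (m : ℕ) (x : Fin m → H) (R : Set (FreeGroup (Fin m))), IsFinitePresentation x R ∧
    ∃ C b : ℝ, 0 < C ∧ 1 < b ∧ IsIsoperimetricFunction R (fun n => C * b ^ n)

/-- The relators of the standard presentation of a graph product, on the disjoint union of the
generating sets `A i`: the relators of the vertex groups, and the commutators `[a, b]` with
`a ∈ A i`, `b ∈ A j` and `i`, `j` joined by an edge. -/
def graphProductRelators {V : Type*} (Γ : SimpleGraph V) {A : V → Type*}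
    (R : ∀ i, Set (FreeGroup (A i))) : Set (FreeGroup (Σ i, A i)) :=
  (⋃ i, FreeGroup.map (fun a : A i => (⟨i, a⟩ : Σ i, A i)) '' R i) ∪
    {r | ∃ i j : V, Γ.Adj i j ∧ ∃ (a : A i) (b : A j),
      r = FreeGroup.of (⟨i, a⟩ : Σ i, A i) * FreeGroup.of (⟨j, b⟩ : Σ i, A i) *
        (FreeGroup.of (⟨i, a⟩ : Σ i, A i))⁻¹ * (FreeGroup.of (⟨j, b⟩ : Σ i, A i))⁻¹}

/-- The maximum of `f n₁ + ⋯ + f nₛ` over all ways of writing `n = n₁ + ⋯ + nₛ` as an ordered sum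
of positive integers (for `n = 0` this is the empty sum `0`). -/
noncomputable def maxPartitionSum (f : ℕ → ℝ) (n : ℕ) : ℝ :=
  (Finset.univ : Finset (Composition n)).sup' Finset.univ_nonempty
    (fun c => (c.blocks.map f).sum)

/-! A word of length n is read from right to left, and the part read so far is kept as a list of
blocks, each a word over one vertex alphabet, whose syllables form a reduced list. If a block at `v`
can be shuffled to the front, a new letter at `v` is moved to it, at the cost of one commutator per
letter passed; otherwise the letter becomes a new front block. If the enlarged block is trivial in
its vertex group, it is deleted at the cost of its area there; otherwise the list is again reduced
(`exists_rewriting`). Each letter passes fewer than n others, so at most n² commutators are used.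

If the word is trivial, the normal form theorem (`IsReduced.eq_nil`) forces the final list to be
empty. Every letter then lies in exactly one deleted block, so the block lengths form a composition
of n and the areas add up to at most `maxPartitionSum f n`. No inverse letters are introduced, so
positive words yield positive blocks.

The normal form theorem is proved by van der Waerden's method: the graph product acts on reduced
lists modulo shuffling, and a reduced list sends the empty trace to its own trace.

The polynomial and exponential cases take a common bound for the finitely many vertex groups; C nᵏ
is superadditive and absorbs n² for k ≥ 2, while an exponential with a larger base absorbs
polynomial factors. -/

namespace GraphProduct

/-! ### Normal form theorem for graph products -/

section NormalForm

variable {V : Type*} (Γ : SimpleGraph V) {G : V → Type*} [∀ i, Group (G i)]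

open Classical in
/-- Split off the `v`-syllable of `L` that can be shuffled to the front of `L`; if there is none,
split off `1`. -/
noncomputable def pop (v : V) : List (Σ i, G i) → G v × List (Σ i, G i)
  | [] => (1, [])
  | p :: L =>
    if e : p.1 = v then (e ▸ p.2, L)
    else if Γ.Adj v p.1 then ((pop v L).1, p :: (pop v L).2)
    else (1, p :: L)

@[simp] lemma pop_nil (v : V) : pop Γ v ([] : List (Σ i, G i)) = (1, []) := rfl

@[simp] lemma pop_cons_self (v : V) (g : G v) (L : List (Σ i, G i)) :
    pop Γ v (⟨v, g⟩ :: L) = (g, L) := by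
  simp [pop]

variable {Γ}

lemma pop_cons_of_adj {v : V} {p : Σ i, G i} (h : Γ.Adj v p.1) (L : List (Σ i, G i)) :
    pop Γ v (p :: L) = ((pop Γ v L).1, p :: (pop Γ v L).2) := by
  have : p.1 ≠ v := h.ne'
  simp [pop, this, h]

lemma pop_cons_of_not_adj {v : V} {p : Σ i, G i} (hne : p.1 ≠ v) (h : ¬ Γ.Adj v p.1)
    (L : List (Σ i, G i)) : pop Γ v (p :: L) = (1, p :: L) := by
  simp [pop, hne, h]

lemma pop_append {v : V} {K : List (Σ i, G i)} (hK : ∀ p ∈ K, Γ.Adj v p.1)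
    (L : List (Σ i, G i)) : pop Γ v (K ++ L) = ((pop Γ v L).1, K ++ (pop Γ v L).2) := by
  induction K with
  | nil => rfl
  | cons p K ih =>
    rw [List.forall_mem_cons] at hK
    rw [List.cons_append, pop_cons_of_adj hK.1, ih hK.2, List.cons_append]

/-- Popping syllables at adjacent vertices commutes. -/
lemma pop_pop {v w : V} (h : Γ.Adj v w) (L : List (Σ i, G i)) :
    (pop Γ v (pop Γ w L).2).1 = (pop Γ v L).1 ∧
      (pop Γ v (pop Γ w L).2).2 = (pop Γ w (pop Γ v L).2).2 := by
  induction L with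
  | nil => simp
  | cons p L ih =>
    by_cases hv : p.1 = v
    · obtain ⟨u, g⟩ := p
      obtain rfl : u = v := hv
      rw [pop_cons_of_adj (p := ⟨u, g⟩) h.symm]
      simp
    by_cases hw : p.1 = w
    · obtain ⟨u, g⟩ := p
      obtain rfl : u = w := hw
      rw [pop_cons_of_adj (p := ⟨u, g⟩) h]
      simp
    by_cases av : Γ.Adj v p.1 <;> by_cases aw : Γ.Adj w p.1 <;>
      simp [pop_cons_of_adj, pop_cons_of_not_adj, hv, hw, av, aw, ih]

variable (Γ) in
/-- A list of syllables is reduced if no syllable is trivial and no two syllables can be merged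
after shuffling. -/
def IsReduced : List (Σ i, G i) → Prop
  | [] => True
  | p :: L => p.2 ≠ 1 ∧ (pop Γ p.1 L).1 = 1 ∧ IsReduced L

/-- Popping could return 1 by removing a trivial syllable; a reduced list has none. -/
lemma IsReduced.pop_snd_eq {v : V} {L : List (Σ i, G i)} (hL : IsReduced Γ L)
    (h : (pop Γ v L).1 = 1) : (pop Γ v L).2 = L := by
  induction L with
  | nil => rfl
  | cons p L ih =>
    obtain ⟨h1, -, h3⟩ := hL
    by_cases hv : p.1 = v
    · obtain ⟨u, g⟩ := p
      obtain rfl : u = v := hv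
      simp at h h1
      exact absurd h h1
    by_cases av : Γ.Adj v p.1
    · rw [pop_cons_of_adj av] at h ⊢
      rw [ih h3 h]
    · rw [pop_cons_of_not_adj hv av]

/-- A second exposed `v`-syllable could have been merged with the first, so reducedness excludes it.
This is what keeps `push` within reduced lists. -/
lemma IsReduced.pop_snd {L : List (Σ i, G i)} (hL : IsReduced Γ L) (v : V) :
    IsReduced Γ (pop Γ v L).2 ∧ (pop Γ v (pop Γ v L).2).1 = 1 := by
  induction L with
  | nil => simp [IsReduced]
  | cons p L ih =>
    have hL' := hL
    obtain ⟨h1, h2, h3⟩ := hL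
    by_cases hv : p.1 = v
    · obtain ⟨u, g⟩ := p
      obtain rfl : u = v := hv
      simpa using ⟨h3, h2⟩
    by_cases av : Γ.Adj v p.1
    · rw [pop_cons_of_adj av]
      refine ⟨⟨h1, ?_, (ih h3).1⟩, ?_⟩
      · rw [(pop_pop av.symm L).1, h2]
      · rw [pop_cons_of_adj av]
        exact (ih h3).2
    · rw [pop_cons_of_not_adj hv av]
      exact ⟨hL', by rw [pop_cons_of_not_adj hv av]⟩

/-- The exposed syllable of a reduced list can be located in the list. -/
lemma exists_eq_append_of_pop_ne_one {v : V} {L : List (Σ i, G i)} (h : (pop Γ v L).1 ≠ 1) :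
    ∃ (K M : List (Σ i, G i)) (g : G v), (∀ p ∈ K, Γ.Adj v p.1) ∧ L = K ++ ⟨v, g⟩ :: M := by
  induction L with
  | nil => simp at h
  | cons p L ih =>
    by_cases hv : p.1 = v
    · obtain ⟨u, g⟩ := p
      obtain rfl : u = v := hv
      exact ⟨[], L, g, by simp, rfl⟩
    by_cases av : Γ.Adj v p.1
    · rw [pop_cons_of_adj av] at h
      obtain ⟨K, M, g, hK, rfl⟩ := ih h
      exact ⟨p :: K, M, g, by simpa [av] using hK, rfl⟩
    · rw [pop_cons_of_not_adj hv av] at h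
      exact absurd rfl h

lemma pop_fst_congr {v w : V} (hvw : v ≠ w) (g g' : G v) (K M : List (Σ i, G i)) :
    (pop Γ w (K ++ ⟨v, g⟩ :: M)).1 = (pop Γ w (K ++ ⟨v, g'⟩ :: M)).1 := by
  induction K with
  | nil =>
    by_cases a : Γ.Adj w v
    · simp [pop_cons_of_adj, a]
    · simp [pop_cons_of_not_adj, a, hvw]
  | cons p K ih =>
    by_cases hp : p.1 = w
    · obtain ⟨u, h⟩ := p
      obtain rfl : u = w := hp
      simp
    by_cases a : Γ.Adj w p.1
    · simp [pop_cons_of_adj, a, ih]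
    · simp [pop_cons_of_not_adj, a, hp]

/-- Replacing a syllable by another nontrivial syllable of the same vertex group keeps a list
reduced. -/
lemma IsReduced.replace {v : V} {g g' : G v} {K M : List (Σ i, G i)}
    (hK : ∀ p ∈ K, Γ.Adj v p.1) (h : IsReduced Γ (K ++ ⟨v, g⟩ :: M)) (hg' : g' ≠ 1) :
    IsReduced Γ (K ++ ⟨v, g'⟩ :: M) := by
  induction K with
  | nil => exact ⟨hg', h.2⟩
  | cons p K ih =>
    rw [List.forall_mem_cons] at hK
    exact ⟨h.1, (pop_fst_congr hK.1.ne _ _ _ _).trans h.2.1, ih hK.2 h.2.2⟩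

/-- Popping at `v` deletes exactly this syllable, since everything in `K` commutes with it. -/
lemma IsReduced.erase {v : V} {g : G v} {K M : List (Σ i, G i)}
    (hK : ∀ p ∈ K, Γ.Adj v p.1) (h : IsReduced Γ (K ++ ⟨v, g⟩ :: M)) :
    IsReduced Γ (K ++ M) := by
  simpa [pop_append hK] using (h.pop_snd v).1

variable (Γ) in
/-- Two lists of syllables that agree up to transpositions of consecutive syllables at adjacent
vertices. -/
inductive Shuffle : List (Σ i, G i) → List (Σ i, G i) → Prop
  | refl (L) : Shuffle L L
  | swap {p q : Σ i, G i} (h : Γ.Adj p.1 q.1) (L) : Shuffle (p :: q :: L) (q :: p :: L)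
  | cons (p) {L M} (h : Shuffle L M) : Shuffle (p :: L) (p :: M)
  | trans {L M N} (h : Shuffle L M) (h' : Shuffle M N) : Shuffle L N

omit [∀ i, Group (G i)] in
lemma Shuffle.length_eq {L M : List (Σ i, G i)} (h : Shuffle Γ L M) : L.length = M.length := by
  induction h <;> simp_all

lemma Shuffle.pop {L M : List (Σ i, G i)} (h : Shuffle Γ L M) (v : V) :
    (pop Γ v L).1 = (pop Γ v M).1 ∧ Shuffle Γ (pop Γ v L).2 (pop Γ v M).2 := by
  induction h with
  | refl L => exact ⟨rfl, .refl _⟩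
  | trans _ _ ih ih' => exact ⟨ih.1.trans ih'.1, ih.2.trans ih'.2⟩
  | cons p h ih =>
    by_cases hv : p.1 = v
    · obtain ⟨u, g⟩ := p
      obtain rfl : u = v := hv
      simpa using h
    by_cases av : Γ.Adj v p.1
    · rw [pop_cons_of_adj av, pop_cons_of_adj av]
      exact ⟨ih.1, ih.2.cons p⟩
    · rw [pop_cons_of_not_adj hv av, pop_cons_of_not_adj hv av]
      exact ⟨rfl, h.cons p⟩
  | @swap p q h L =>
    by_cases hp : p.1 = v
    · obtain ⟨u, g⟩ := p
      obtain rfl : u = v := hp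
      rw [pop_cons_of_adj (p := q) h]
      simpa using .refl _
    by_cases hq : q.1 = v
    · obtain ⟨u, g⟩ := q
      obtain rfl : u = v := hq
      rw [pop_cons_of_adj (p := p) h.symm]
      simpa using .refl _
    by_cases ap : Γ.Adj v p.1 <;> by_cases aq : Γ.Adj v q.1 <;>
      simpa [pop_cons_of_adj, pop_cons_of_not_adj, hp, hq, ap, aq] using .swap h _

open Classical in
/-- Put a syllable in front of a list, dropping it if it is trivial. -/
noncomputable def glue (v : V) (g : G v) (L : List (Σ i, G i)) : List (Σ i, G i) :=
  if g = 1 then L else ⟨v, g⟩ :: L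

lemma pop_glue_self {v : V} (g : G v) {L : List (Σ i, G i)} (hL : IsReduced Γ L)
    (h : (pop Γ v L).1 = 1) : pop Γ v (glue v g L) = (g, L) := by
  by_cases hg : g = 1
  · simp only [glue, hg, if_true]
    exact Prod.ext h (hL.pop_snd_eq h)
  · simp [glue, hg]

lemma pop_glue_of_adj {v w : V} (a : Γ.Adj v w) (g : G w) (L : List (Σ i, G i)) :
    pop Γ v (glue w g L) = ((pop Γ v L).1, glue w g (pop Γ v L).2) := by
  by_cases hg : g = 1
  · simp [glue, hg]
  · simp only [glue, hg, if_false]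
    exact pop_cons_of_adj (p := ⟨w, g⟩) a L

lemma IsReduced.glue {v : V} (g : G v) {L : List (Σ i, G i)} (hL : IsReduced Γ L)
    (h : (GraphProduct.pop Γ v L).1 = 1) : IsReduced Γ (glue v g L) := by
  by_cases hg : g = 1
  · simpa [GraphProduct.glue, hg] using hL
  · simp only [GraphProduct.glue, hg, if_false]
    exact ⟨hg, h, hL⟩

lemma Shuffle.glue {L M : List (Σ i, G i)} (h : Shuffle Γ L M) (v : V) (g : G v) :
    Shuffle Γ (glue v g L) (glue v g M) := by
  by_cases hg : g = 1
  · simpa [GraphProduct.glue, hg] using h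
  · simpa [GraphProduct.glue, hg] using h.cons _

lemma shuffle_glue_glue {v w : V} (a : Γ.Adj v w) (g : G v) (h : G w) (L : List (Σ i, G i)) :
    Shuffle Γ (glue v g (glue w h L)) (glue w h (glue v g L)) := by
  by_cases hg : g = 1 <;> by_cases hh : h = 1 <;> simp only [glue, hg, hh, if_true, if_false]
  iterate 3 exact .refl _
  exact .swap a L

variable (Γ) in
/-- Left multiplication of a list of syllables by an element of a vertex group. -/
noncomputable def push (v : V) (g : G v) (L : List (Σ i, G i)) : List (Σ i, G i) :=
  glue v (g * (pop Γ v L).1) (pop Γ v L).2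

lemma IsReduced.push {L : List (Σ i, G i)} (hL : IsReduced Γ L) (v : V) (g : G v) :
    IsReduced Γ (push Γ v g L) :=
  (hL.pop_snd v).1.glue _ (hL.pop_snd v).2

lemma Shuffle.push {L M : List (Σ i, G i)} (h : Shuffle Γ L M) (v : V) (g : G v) :
    Shuffle Γ (push Γ v g L) (push Γ v g M) := by
  unfold GraphProduct.push
  rw [(h.pop v).1]
  exact (h.pop v).2.glue _ _

lemma push_of_isReduced_cons {L : List (Σ i, G i)} {v : V} {g : G v}
    (hL : IsReduced Γ (⟨v, g⟩ :: L)) : push Γ v g L = ⟨v, g⟩ :: L := by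
  have h1 : (pop Γ v L).1 = 1 := hL.2.1
  have h2 : g ≠ 1 := hL.1
  simp only [push, h1, mul_one, glue, h2, if_false]
  rw [hL.2.2.pop_snd_eq h1]

/-- Pushing 1 moves the exposed `v`-syllable to the front. The list itself may change, which is why
the action is defined only on traces. -/
lemma IsReduced.shuffle_push_one {L : List (Σ i, G i)} (hL : IsReduced Γ L) (v : V) :
    Shuffle Γ (GraphProduct.push Γ v 1 L) L := by
  induction L with
  | nil => simpa [GraphProduct.push, GraphProduct.glue] using .refl _
  | cons p L ih =>
    by_cases hv : p.1 = v
    · obtain ⟨u, g⟩ := p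
      obtain rfl : u = v := hv
      have hg : g ≠ 1 := hL.1
      simpa [GraphProduct.push, GraphProduct.glue, hg] using .refl _
    by_cases av : Γ.Adj v p.1
    · refine .trans ?_ ((ih hL.2.2).cons p)
      rw [GraphProduct.push, GraphProduct.push, pop_cons_of_adj av]
      by_cases hk : 1 * (GraphProduct.pop Γ v L).1 = 1
      · simpa only [GraphProduct.glue, hk, if_true] using .refl _
      · simpa only [GraphProduct.glue, hk, if_false] using .swap (p := ⟨v, _⟩) av _
    · simpa [GraphProduct.push, GraphProduct.glue, pop_cons_of_not_adj, hv, av] using .refl _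

lemma push_push {L : List (Σ i, G i)} (hL : IsReduced Γ L) (v : V) (g h : G v) :
    push Γ v g (push Γ v h L) = push Γ v (g * h) L := by
  have := hL.pop_snd v
  rw [push, push, pop_glue_self _ this.1 this.2, push, mul_assoc]

variable (Γ G) in
/-- Reduced lists of syllables up to shuffling. -/
def ReducedTrace : Type _ :=
  Quot fun L M : {L : List (Σ i, G i) // IsReduced Γ L} => Shuffle Γ L.1 M.1

/-- The trace of a reduced list. -/
def ReducedTrace.mk (L : List (Σ i, G i)) (hL : IsReduced Γ L) : ReducedTrace Γ G :=
  Quot.mk _ ⟨L, hL⟩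

lemma ReducedTrace.sound {L M : List (Σ i, G i)} (hL : IsReduced Γ L) (hM : IsReduced Γ M)
    (h : Shuffle Γ L M) : ReducedTrace.mk L hL = ReducedTrace.mk M hM :=
  Quot.sound h

/-- Length is invariant under shuffling, hence well defined on traces. -/
lemma ReducedTrace.eq_nil {L : List (Σ i, G i)} {hL : IsReduced Γ L}
    (h : ReducedTrace.mk L hL = ReducedTrace.mk [] trivial) : L = [] :=
  List.length_eq_zero_iff.1 <| congrArg
    (Quot.lift (fun L : {L : List (Σ i, G i) // IsReduced Γ L} => L.1.length)
      fun _ _ h => h.length_eq) h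

variable (Γ) in
/-- The action of an element of a vertex group on reduced traces. -/
noncomputable def pushTrace (v : V) (g : G v) : ReducedTrace Γ G → ReducedTrace Γ G :=
  Quot.map (fun L => ⟨push Γ v g L.1, L.2.push v g⟩) fun _ _ h => h.push v g

variable (Γ) in
/-- The action of a vertex group on reduced traces. -/
noncomputable def vertexAction (v : V) : G v →* Function.End (ReducedTrace Γ G) where
  toFun g := pushTrace Γ v g
  map_one' := by
    funext t
    obtain ⟨L, hL⟩ := t
    exact ReducedTrace.sound (hL.push v 1) hL (hL.shuffle_push_one v)
  map_mul' g h := by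
    funext t
    obtain ⟨L, hL⟩ := t
    exact ReducedTrace.sound (hL.push v (g * h)) ((hL.push v h).push v g)
      (push_push hL v g h ▸ .refl _)

/-- Popping at `v` and at `w` do not interfere, so the two orders can differ only by a swap of the
two front syllables. -/
lemma vertexAction_comm {v w : V} (a : Γ.Adj v w) (g : G v) (h : G w) :
    vertexAction Γ v g * vertexAction Γ w h = vertexAction Γ w h * vertexAction Γ v g := by
  funext t
  obtain ⟨L, hL⟩ := t
  refine ReducedTrace.sound ((hL.push w h).push v g) ((hL.push v g).push w h) ?_
  simp only [push, pop_glue_of_adj a, pop_glue_of_adj a.symm]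
  rw [(pop_pop a L).1, (pop_pop a.symm L).1, (pop_pop a L).2]
  exact shuffle_glue_glue a _ _ _

variable (Γ G) in
/-- The action of the free product of the vertex groups on reduced traces. -/
noncomputable def traceAction : Monoid.CoprodI G →* (Function.End (ReducedTrace Γ G))ˣ :=
  (Monoid.CoprodI.lift (vertexAction Γ)).toHomUnits

lemma coe_traceAction_of {v : V} (g : G v) :
    (traceAction Γ G (Monoid.CoprodI.of g) : Function.End (ReducedTrace Γ G)) =
      vertexAction Γ v g := by
  simp [traceAction]

lemma normalClosure_le_ker_traceAction :
    Subgroup.normalClosure (graphProductCommutators Γ G) ≤ (traceAction Γ G).ker := by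
  refine Subgroup.normalClosure_le_normal ?_
  rintro _ ⟨i, j, a, g, h, rfl⟩
  have : traceAction Γ G (.of g) * traceAction Γ G (.of h) =
      traceAction Γ G (.of h) * traceAction Γ G (.of g) :=
    Units.ext (by simpa only [Units.val_mul, coe_traceAction_of] using vertexAction_comm a g h)
  simp only [SetLike.mem_coe, MonoidHom.mem_ker, map_mul, map_inv]
  rw [this]
  group

/-- The element of the free product represented by a list of syllables. -/
def coprodOfList (L : List (Σ i, G i)) : Monoid.CoprodI G :=
  (L.map fun p => Monoid.CoprodI.of p.2).prod

/-- Building the list from the right, each push meets no syllable to merge with and simply prepends.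
-/
lemma traceAction_coprodOfList {L : List (Σ i, G i)} (hL : IsReduced Γ L) :
    (traceAction Γ G (coprodOfList L) : Function.End (ReducedTrace Γ G))
      (ReducedTrace.mk [] trivial) = ReducedTrace.mk L hL := by
  induction L with
  | nil => simp [coprodOfList]; rfl
  | cons p L ih =>
    have : coprodOfList (p :: L) = Monoid.CoprodI.of p.2 * coprodOfList L := by
      simp [coprodOfList]
    rw [this, map_mul, Units.val_mul, coe_traceAction_of]
    refine (congrArg (vertexAction Γ p.1 p.2) (ih hL.2.2)).trans ?_
    exact ReducedTrace.sound (hL.2.2.push _ _) hL (push_of_isReduced_cons hL ▸ .refl _)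

/-- The normal form theorem for graph products: a nonempty reduced list of syllables represents a
nontrivial element. -/
theorem IsReduced.eq_nil {L : List (Σ i, G i)} (hL : IsReduced Γ L)
    (h : (L.map fun p => GraphProduct.of Γ G p.1 p.2).prod = 1) : L = [] := by
  have h1 : QuotientGroup.mk' (Subgroup.normalClosure (graphProductCommutators Γ G))
      (coprodOfList L) = 1 := by
    rw [coprodOfList, map_list_prod, List.map_map]
    exact h
  have h2 : coprodOfList L ∈ (traceAction Γ G).ker :=
    normalClosure_le_ker_traceAction ((QuotientGroup.eq_one_iff _).1 h1)
  have h3 := traceAction_coprodOfList hL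
  rw [MonoidHom.mem_ker.1 h2] at h3
  exact ReducedTrace.eq_nil h3.symm

end NormalForm

end GraphProduct

/-! ### Calculus of areas -/

namespace IsProdOfConjugates

variable {F F' : Type*} [Group F] [Group F'] {R : Set F} {m n : ℕ} {w u : F}

lemma one : IsProdOfConjugates R 0 1 := ⟨[], by simp⟩

lemma mul (hw : IsProdOfConjugates R m w) (hu : IsProdOfConjugates R n u) :
    IsProdOfConjugates R (m + n) (w * u) := by
  obtain ⟨l, rfl, rfl, h⟩ := hw
  obtain ⟨l', rfl, rfl, h'⟩ := hu
  refine ⟨l ++ l', by simp, by simp, fun y hy => ?_⟩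
  rcases List.mem_append.1 hy with hy | hy
  exacts [h y hy, h' y hy]

lemma conj (hw : IsProdOfConjugates R m w) (c : F) : IsProdOfConjugates R m (c * w * c⁻¹) := by
  obtain ⟨l, rfl, rfl, h⟩ := hw
  refine ⟨l.map (MulAut.conj c), by simp, by rw [← map_list_prod, MulAut.conj_apply], ?_⟩
  intro y hy
  obtain ⟨z, hz, rfl⟩ := List.mem_map.1 hy
  obtain ⟨r, hr, d, rfl | rfl⟩ := h z hz
  · exact ⟨r, hr, c * d, .inl (by simp [mul_assoc])⟩
  · exact ⟨r, hr, c * d, .inr (by simp [mul_assoc])⟩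

lemma inv (hw : IsProdOfConjugates R m w) : IsProdOfConjugates R m w⁻¹ := by
  obtain ⟨l, rfl, rfl, h⟩ := hw
  refine ⟨(l.map (·⁻¹)).reverse, by simp, by rw [List.prod_inv_reverse], ?_⟩
  intro y hy
  obtain ⟨z, hz, rfl⟩ := List.mem_map.1 (List.mem_reverse.1 hy)
  obtain ⟨r, hr, d, rfl | rfl⟩ := h z hz
  · exact ⟨r, hr, d, .inr (by group)⟩
  · exact ⟨r, hr, d, .inl (by group)⟩

lemma of_mem {r : F} (hr : r ∈ R) : IsProdOfConjugates R 1 r :=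
  ⟨[r], by simp, by simp, fun y hy => ⟨r, hr, 1, .inl (by simpa using hy)⟩⟩

lemma map (hw : IsProdOfConjugates R m w) (φ : F →* F') {R' : Set F'}
    (hφ : ∀ r ∈ R, φ r ∈ R') : IsProdOfConjugates R' m (φ w) := by
  obtain ⟨l, rfl, rfl, h⟩ := hw
  refine ⟨l.map φ, by simp, by rw [← map_list_prod], ?_⟩
  intro y hy
  obtain ⟨z, hz, rfl⟩ := List.mem_map.1 hy
  obtain ⟨r, hr, d, rfl | rfl⟩ := h z hz
  · exact ⟨φ r, hφ r hr, φ d, .inl (by simp)⟩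
  · exact ⟨φ r, hφ r hr, φ d, .inr (by simp)⟩

lemma mem_normalClosure (hw : IsProdOfConjugates R m w) : w ∈ Subgroup.normalClosure R := by
  obtain ⟨l, -, rfl, h⟩ := hw
  refine Subgroup.list_prod_mem _ fun y hy => ?_
  obtain ⟨r, hr, d, rfl | rfl⟩ := h y hy
  · exact Subgroup.normalClosure_normal.conj_mem _ (Subgroup.subset_normalClosure hr) d
  · exact Subgroup.normalClosure_normal.conj_mem _
      (inv_mem (Subgroup.subset_normalClosure hr)) d

lemma exists_of_mem_normalClosure (hw : w ∈ Subgroup.normalClosure R) :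
    ∃ m, IsProdOfConjugates R m w := by
  induction hw using Subgroup.closure_induction with
  | mem x hx =>
    obtain ⟨r, hr, hx⟩ := Group.mem_conjugatesOfSet_iff.1 hx
    obtain ⟨c, rfl⟩ := isConj_iff.1 hx
    exact ⟨1, (of_mem hr).conj c⟩
  | one => exact ⟨0, .one⟩
  | mul x y _ _ hx hy =>
    obtain ⟨m, hm⟩ := hx
    obtain ⟨n, hn⟩ := hy
    exact ⟨m + n, hm.mul hn⟩
  | inv x _ hx =>
    obtain ⟨m, hm⟩ := hx
    exact ⟨m, hm.inv⟩

/-- The cost of commuting `b` past a product is at most the sum of the costs for the factors. -/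
lemma commutator_list_prod {ι : Type*} (b : F) (y : ι → F) (c : ι → ℕ) (l : List ι)
    (h : ∀ i ∈ l, IsProdOfConjugates R (c i) (b * y i * b⁻¹ * (y i)⁻¹)) :
    IsProdOfConjugates R (l.map c).sum (b * (l.map y).prod * b⁻¹ * (l.map y).prod⁻¹) := by
  induction l with
  | nil => simpa using one
  | cons i l ih =>
    rw [List.forall_mem_cons] at h
    -- The identity used is [b, yY] = [b, y] · y[b, Y]y⁻¹.
    have := h.1.mul ((ih h.2).conj (y i))
    rw [List.map_cons, List.sum_cons, List.map_cons, List.prod_cons]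
    convert this using 1
    group

/-- If the commutator of `x` and `y` is a relator, then commuting `x⁻¹` or `x` past `y⁻¹` or `y`
costs one relator. -/
lemma commutator_signed {x y s t : F} (h : x * y * x⁻¹ * y⁻¹ ∈ R)
    (hs : s = x ∨ s = x⁻¹) (ht : t = y ∨ t = y⁻¹) :
    IsProdOfConjugates R 1 (s * t * s⁻¹ * t⁻¹) := by
  have h := of_mem h
  rcases hs with rfl | rfl <;> rcases ht with rfl | rfl
  · exact h
  · convert h.inv.conj y⁻¹ using 1; group
  · convert h.inv.conj x⁻¹ using 1; group
  · convert h.conj (x⁻¹ * y⁻¹) using 1; group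

end IsProdOfConjugates

/-! ### Standard presentation and rewriting of words into reduced blocks -/

namespace GraphProduct

variable {V : Type*} {Γ : SimpleGraph V} {G : V → Type*} [∀ i, Group (G i)]

lemma of_commute {i j : V} (h : Γ.Adj i j) (a : G i) (b : G j) :
    of Γ G i a * of Γ G j b * (of Γ G i a)⁻¹ * (of Γ G j b)⁻¹ = 1 :=
  (QuotientGroup.eq_one_iff (N := Subgroup.normalClosure (graphProductCommutators Γ G)) _).2
    (Subgroup.subset_normalClosure ⟨i, j, h, a, b, rfl⟩)

section Presentation

variable {A : V → Type*} (x : ∀ i, A i → G i) (R : ∀ i, Set (FreeGroup (A i)))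

variable (Γ) in
/-- The evaluation of the words in all generators in the graph product. -/
def eval : FreeGroup (Σ i, A i) →* GraphProduct Γ G :=
  FreeGroup.lift fun a : Σ i, A i => of Γ G a.1 (x a.1 a.2)

/-- The inclusion of the free group on one generating set. -/
def incl (i : V) : FreeGroup (A i) →* FreeGroup (Σ i, A i) :=
  FreeGroup.map fun a => ⟨i, a⟩

lemma eval_incl (i : V) (w : FreeGroup (A i)) :
    eval Γ x (incl i w) = of Γ G i (FreeGroup.lift (x i) w) := by
  have : (eval Γ x).comp (incl i) = (of Γ G i).comp (FreeGroup.lift (x i)) := by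
    ext a
    simp [eval, incl]
  exact DFunLike.congr_fun this w

variable {x R}

lemma normalClosure_le_ker_eval (hR : ∀ i, ∀ r ∈ R i, FreeGroup.lift (x i) r = 1) :
    Subgroup.normalClosure (graphProductRelators Γ R) ≤ (eval Γ x).ker := by
  refine Subgroup.normalClosure_le_normal ?_
  rintro _ (h | ⟨i, j, h, a, b, rfl⟩)
  · obtain ⟨i, r, hr, rfl⟩ := Set.mem_iUnion.1 h
    exact (eval_incl x i r).trans (by rw [hR i r hr, map_one])
  · simpa [eval] using of_commute h (x i a) (x j b)

lemma eval_surjective (hx : ∀ i, Function.Surjective (FreeGroup.lift (x i))) :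
    Function.Surjective (eval Γ x) := by
  rw [← MonoidHom.range_eq_top, eq_top_iff]
  rintro y -
  induction y using QuotientGroup.induction_on with | H y =>
  induction y using Monoid.CoprodI.induction_on with
  | one => exact one_mem _
  | of i g =>
    obtain ⟨w, rfl⟩ := hx i g
    exact ⟨incl i w, eval_incl x i w⟩
  | mul y z hy hz => exact mul_mem hy hz

section Rewriting

variable {B : V → Type*} (ι : ∀ i, B i → FreeGroup (A i))

/-- The element of the free group spelled by a word over a vertex alphabet. -/
def spell {i : V} (k : List (B i)) : FreeGroup (A i) := (k.map (ι i)).prod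

/-- The element spelled by a word over the union of all vertex alphabets. -/
def spellAll (W : List (Σ i, B i)) : FreeGroup (Σ i, A i) :=
  (W.map fun b => incl b.1 (ι b.1 b.2)).prod

/-- The element spelled by a list of words over vertex alphabets. -/
def spellBlocks (S : List (Σ i, List (B i))) : FreeGroup (Σ i, A i) :=
  (S.map fun p => incl p.1 (spell ι p.2)).prod

/-- The number of letters in a list of words. -/
def letterCount (S : List (Σ i, List (B i))) : ℕ := (S.map fun p => p.2.length).sum

variable (x) in
/-- The list of syllables represented by a list of words. -/
def syllables (S : List (Σ i, List (B i))) : List (Σ i, G i) :=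
  S.map fun p => ⟨p.1, FreeGroup.lift (x p.1) (spell ι p.2)⟩

variable {ι}

@[simp] lemma spellBlocks_append (S S' : List (Σ i, List (B i))) :
    spellBlocks ι (S ++ S') = spellBlocks ι S * spellBlocks ι S' := by simp [spellBlocks]

@[simp] lemma spellBlocks_cons (p : Σ i, List (B i)) (S : List (Σ i, List (B i))) :
    spellBlocks ι (p :: S) = incl p.1 (spell ι p.2) * spellBlocks ι S := by simp [spellBlocks]

@[simp] lemma letterCount_append (S S' : List (Σ i, List (B i))) :
    letterCount (S ++ S') = letterCount S + letterCount S' := by simp [letterCount]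

@[simp] lemma letterCount_cons (p : Σ i, List (B i)) (S : List (Σ i, List (B i))) :
    letterCount (p :: S) = p.2.length + letterCount S := by simp [letterCount]

lemma eval_spellBlocks (S : List (Σ i, List (B i))) :
    eval Γ x (spellBlocks ι S) = ((syllables x ι S).map fun p => of Γ G p.1 p.2).prod := by
  simp only [spellBlocks, syllables, map_list_prod, List.map_map, Function.comp_def, eval_incl]

/-- A letter commutes with a list of blocks at adjacent vertices at the cost of one relator for
each letter of the list. -/
lemma isProdOfConjugates_commutator_spellBlocks
    (hι : ∀ i (b : B i), ∃ a, ι i b = FreeGroup.of a ∨ ι i b = (FreeGroup.of a)⁻¹)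
    {v : V} (b : B v) (S : List (Σ i, List (B i))) (hS : ∀ p ∈ S, Γ.Adj v p.1) :
    IsProdOfConjugates (graphProductRelators Γ R) (letterCount S)
      (incl v (ι v b) * spellBlocks ι S * (incl v (ι v b))⁻¹ * (spellBlocks ι S)⁻¹) := by
  refine IsProdOfConjugates.commutator_list_prod _ _ _ S fun p hp => ?_
  rw [spell, map_list_prod, List.map_map]
  have := IsProdOfConjugates.commutator_list_prod (R := graphProductRelators Γ R)
    (incl v (ι v b)) (incl p.1 ∘ ι p.1) (fun _ => 1) p.2 fun c _ => ?_
  · simpa using this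
  · obtain ⟨a, ha⟩ := hι v b
    obtain ⟨a', ha'⟩ := hι p.1 c
    refine IsProdOfConjugates.commutator_signed
      (x := FreeGroup.of ⟨v, a⟩) (y := FreeGroup.of ⟨p.1, a'⟩)
      (.inr ⟨v, p.1, hS p hp, a, a', rfl⟩) ?_ ?_
    · rcases ha with ha | ha <;> simp [ha, incl]
    · rcases ha' with ha' | ha' <;> simp [ha', incl]

/-- The place in a reduced list of blocks where a letter at `v` is to be inserted. -/
lemma exists_insertion {S : List (Σ i, List (B i))} (hS : IsReduced Γ (syllables x ι S)) (v : V) :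
    ∃ (S₁ S₂ : List (Σ i, List (B i))) (k : List (B v)), (∀ p ∈ S₁, Γ.Adj v p.1) ∧
      spellBlocks ι S = spellBlocks ι S₁ * incl v (spell ι k) * spellBlocks ι S₂ ∧
      letterCount S = letterCount S₁ + k.length + letterCount S₂ ∧
      IsReduced Γ (syllables x ι (S₁ ++ S₂)) ∧
      ∀ k' : List (B v), FreeGroup.lift (x v) (spell ι k') ≠ 1 →
        IsReduced Γ (syllables x ι (S₁ ++ ⟨v, k'⟩ :: S₂)) := by
  by_cases h : (pop Γ v (syllables x ι S)).1 = 1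
  -- No syllable at `v` is exposed: the letter joins an empty block at the front.
  · exact ⟨[], S, [], by simp, by simp [spellBlocks, spell], by simp [letterCount], hS,
      fun k' hk' => ⟨hk', h, hS⟩⟩
  · obtain ⟨K, M, g, hK, hKM⟩ := exists_eq_append_of_pop_ne_one h
    obtain ⟨S₁, T, rfl, rfl, hT⟩ := List.map_eq_append_iff.1 hKM
    obtain ⟨⟨u, k⟩, S₂, rfl, hu, rfl⟩ := List.map_eq_cons_iff.1 hT
    obtain rfl : u = v := congrArg Sigma.fst hu
    have hS₁ : ∀ p ∈ S₁, Γ.Adj u p.1 := fun p hp => hK _ (List.mem_map_of_mem hp)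
    refine ⟨S₁, S₂, k, hS₁, by simp [mul_assoc], by simp [add_assoc], ?_, fun k' hk' => ?_⟩
    · simp only [syllables, List.map_append, List.map_cons] at hS ⊢
      exact hS.erase hK
    · simp only [syllables, List.map_append, List.map_cons] at hS ⊢
      exact hS.replace hK hk'

/-- Rewriting a word into a reduced list of blocks, letter by letter. The list `l` records the
lengths and areas of the trivial blocks that are deleted on the way. -/
lemma exists_rewriting
    (hι : ∀ i (b : B i), ∃ a, ι i b = FreeGroup.of a ∨ ι i b = (FreeGroup.of a)⁻¹)
    {T : ℕ → ℕ → Prop}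
    (hT : ∀ i (k : List (B i)), FreeGroup.lift (x i) (spell ι k) = 1 →
      ∃ m, T k.length m ∧ IsProdOfConjugates (R i) m (spell ι k))
    (W : List (Σ i, B i)) :
    ∃ (S : List (Σ i, List (B i))) (l : List (ℕ × ℕ)) (c : ℕ),
      IsReduced Γ (syllables x ι S) ∧ (∀ p ∈ l, 0 < p.1 ∧ T p.1 p.2) ∧
      letterCount S + (l.map Prod.fst).sum = W.length ∧ c ≤ W.length ^ 2 ∧
      IsProdOfConjugates (graphProductRelators Γ R) ((l.map Prod.snd).sum + c)
        (spellAll ι W * (spellBlocks ι S)⁻¹) := by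
  induction W with
  | nil => exact ⟨[], [], 0, trivial, by simp, by simp [letterCount], by simp,
      by simpa [spellAll, spellBlocks] using .one⟩
  | cons b W ih =>
    obtain ⟨v, b⟩ := b
    obtain ⟨S, l, c, hS, hl, hlen, hc, hW⟩ := ih
    obtain ⟨S₁, S₂, k, hS₁, hspell, hcount, hred, hins⟩ := exists_insertion hS v
    have hcomm := isProdOfConjugates_commutator_spellBlocks (R := R) hι b S₁ hS₁
    have hS₁W : letterCount S₁ ≤ W.length := by omega
    have hcost : letterCount S₁ + c ≤ (W.length + 1) ^ 2 := by nlinarith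
    have hbW : spellAll ι (⟨v, b⟩ :: W) = incl v (ι v b) * spellAll ι W := by simp [spellAll]
    have hbk : spell ι (b :: k) = ι v b * spell ι k := by simp [spell]
    -- The element is (bW)(S₁ · bk · S₂)⁻¹: conjugate the old relation by b, then move b past S₁.
    have key := (hW.conj (incl v (ι v b))).mul hcomm
    by_cases htriv : FreeGroup.lift (x v) (spell ι (b :: k)) = 1
    · obtain ⟨m, hm, hprod⟩ := hT v _ htriv
      have hblock : IsProdOfConjugates (graphProductRelators Γ R) m
          (incl v (spell ι (b :: k))) :=
        hprod.map (incl v) fun r hr => .inl (Set.mem_iUnion.2 ⟨v, r, hr, rfl⟩)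
      -- The deleted block contains the new letter, so its recorded length is positive.
      refine ⟨S₁ ++ S₂, (k.length + 1, m) :: l, letterCount S₁ + c, hred, ?_, ?_, hcost, ?_⟩
      · simpa [List.forall_mem_cons] using ⟨hm, fun a b h => hl (a, b) h⟩
      · simp; omega
      · convert key.mul (hblock.conj (spellBlocks ι S₁)) using 1
        · simp; omega
        · rw [hbW, hbk, hspell, spellBlocks_append, map_mul]
          group
    · refine ⟨S₁ ++ ⟨v, b :: k⟩ :: S₂, l, letterCount S₁ + c, hins _ htriv, hl, ?_, hcost, ?_⟩
      · simp; omega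
      · convert key using 1
        · omega
        · rw [hbW, spellBlocks_append, spellBlocks_cons, hbk, hspell, map_mul]
          group

/-- A word that is trivial in the graph product is a product of conjugates of relators whose
number is controlled by the areas of trivial words over the vertex alphabets. -/
theorem exists_isProdOfConjugates
    (hι : ∀ i (b : B i), ∃ a, ι i b = FreeGroup.of a ∨ ι i b = (FreeGroup.of a)⁻¹)
    (hR : ∀ i, ∀ r ∈ R i, FreeGroup.lift (x i) r = 1) {T : ℕ → ℕ → Prop}
    (hT : ∀ i (k : List (B i)), FreeGroup.lift (x i) (spell ι k) = 1 →
      ∃ m, T k.length m ∧ IsProdOfConjugates (R i) m (spell ι k))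
    (W : List (Σ i, B i)) (hW : eval Γ x (spellAll ι W) = 1) :
    ∃ (l : List (ℕ × ℕ)) (c : ℕ), (∀ p ∈ l, 0 < p.1 ∧ T p.1 p.2) ∧
      (l.map Prod.fst).sum = W.length ∧ c ≤ W.length ^ 2 ∧
      IsProdOfConjugates (graphProductRelators Γ R) ((l.map Prod.snd).sum + c)
        (spellAll ι W) := by
  obtain ⟨S, l, c, hS, hl, hlen, hc, hprod⟩ := exists_rewriting (Γ := Γ) hι hT W
  have h1 : eval Γ x (spellAll ι W * (spellBlocks ι S)⁻¹) = 1 :=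
    normalClosure_le_ker_eval hR hprod.mem_normalClosure
  rw [map_mul, hW, one_mul, map_inv, inv_eq_one, eval_spellBlocks] at h1
  obtain rfl : S = [] := List.map_eq_nil_iff.1 (hS.eq_nil h1)
  exact ⟨l, c, hl, by simpa [letterCount] using hlen, hc, by simpa [spellBlocks] using hprod⟩

end Rewriting

end Presentation

end GraphProduct

/-! ### From rewriting to isoperimetric functions -/

lemma FreeGroup.mk_eq_prod_map {α : Type*} (w : List (α × Bool)) :
    FreeGroup.mk w = (w.map fun b => FreeGroup.mk [b]).prod := by
  induction w with
  | nil => rfl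
  | cons b w ih => rw [List.map_cons, List.prod_cons, ← ih, FreeGroup.mul_mk]; rfl

lemma FreeGroup.mk_singleton_eq {α : Type*} (b : α × Bool) :
    FreeGroup.mk [b] = FreeGroup.of b.1 ∨ FreeGroup.mk [b] = (FreeGroup.of b.1)⁻¹ := by
  obtain ⟨a, _ | _⟩ := b
  · exact .inr (by simp [FreeGroup.of, FreeGroup.inv_mk, FreeGroup.invRev])
  · exact .inl rfl

lemma sum_le_maxPartitionSum (f : ℕ → ℝ) (l : List (ℕ × ℕ))
    (hl : ∀ p ∈ l, 0 < p.1 ∧ (p.2 : ℝ) ≤ f p.1) :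
    (((l.map Prod.snd).sum : ℕ) : ℝ) ≤ maxPartitionSum f (l.map Prod.fst).sum := by
  have h1 : (((l.map Prod.snd).sum : ℕ) : ℝ) ≤ ((l.map Prod.fst).map f).sum := by
    rw [Nat.cast_list_sum, List.map_map, List.map_map]
    exact List.sum_le_sum fun p hp => (hl p hp).2
  let c : Composition (l.map Prod.fst).sum :=
    ⟨l.map Prod.fst, fun {i} hi => by
      obtain ⟨p, hp, rfl⟩ := List.mem_map.1 hi
      exact (hl p hp).1, rfl⟩
  exact h1.trans (Finset.le_sup' (fun c : Composition _ => (c.blocks.map f).sum)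
    (Finset.mem_univ c))

lemma maxPartitionSum_le {f : ℕ → ℝ} {n : ℕ} {a : ℝ}
    (h : ∀ c : Composition n, (c.blocks.map f).sum ≤ a) : maxPartitionSum f n ≤ a :=
  Finset.sup'_le _ _ fun c _ => h c

namespace GraphProduct

variable {V : Type*} {Γ : SimpleGraph V} {G : V → Type*} [∀ i, Group (G i)]
  {A : V → Type*} {x : ∀ i, A i → G i} {R : ∀ i, Set (FreeGroup (A i))}

lemma spell_mk {i : V} (k : List (A i × Bool)) :
    spell (fun _ b => FreeGroup.mk [b]) k = FreeGroup.mk k :=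
  (FreeGroup.mk_eq_prod_map k).symm

lemma spellAll_mk (W : List ((Σ i, A i) × Bool)) :
    spellAll (B := fun i => A i × Bool) (fun _ b => FreeGroup.mk [b])
      (W.map fun b => ⟨b.1.1, b.1.2, b.2⟩) = FreeGroup.mk W := by
  rw [FreeGroup.mk_eq_prod_map, spellAll, List.map_map]
  rfl

lemma spellAll_of (W : List (Σ i, A i)) :
    spellAll (fun _ a => FreeGroup.of a) W = (W.map FreeGroup.of).prod := by
  simp [spellAll, incl]

lemma lift_eq_one_of_mem (hR : ∀ i, (FreeGroup.lift (x i)).ker = Subgroup.normalClosure (R i))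
    (i : V) (r : FreeGroup (A i)) (hr : r ∈ R i) : FreeGroup.lift (x i) r = 1 :=
  MonoidHom.mem_ker.1 (hR i ▸ Subgroup.subset_normalClosure hr)

/-- The rewriting is applied with no constraint on the areas: it already exhibits a word trivial in
the graph product as a product of conjugates of relators. -/
theorem ker_eval (hR : ∀ i, (FreeGroup.lift (x i)).ker = Subgroup.normalClosure (R i)) :
    (eval Γ x).ker = Subgroup.normalClosure (graphProductRelators Γ R) := by
  refine le_antisymm (fun w hw => ?_) (normalClosure_le_ker_eval (lift_eq_one_of_mem hR))
  obtain ⟨W, rfl⟩ := Quot.exists_rep w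
  change FreeGroup.mk W ∈ _ at hw
  change FreeGroup.mk W ∈ _
  rw [← spellAll_mk] at hw ⊢
  obtain ⟨l, c, -, -, -, h⟩ := exists_isProdOfConjugates (T := fun _ _ => True)
    (fun i b => ⟨b.1, FreeGroup.mk_singleton_eq b⟩) (lift_eq_one_of_mem hR)
    (fun i k hk => by
      rw [← MonoidHom.mem_ker, hR] at hk
      simpa using IsProdOfConjugates.exists_of_mem_normalClosure hk) _ (MonoidHom.mem_ker.1 hw)
  exact h.mem_normalClosure

theorem isFinitePresentation [Finite V] (h : ∀ i, IsFinitePresentation (x i) (R i)) :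
    IsFinitePresentation (fun a : Σ i, A i => of Γ G a.1 (x a.1 a.2))
      (graphProductRelators Γ R) where
  finite_generators :=
    have := fun i => (h i).finite_generators
    inferInstance
  finite_relators := by
    have := fun i => (h i).finite_generators
    refine (Set.finite_iUnion fun i => (h i).finite_relators.image _).union ?_
    refine (Set.finite_range fun p : (Σ i, A i) × (Σ i, A i) => FreeGroup.of p.1 *
      FreeGroup.of p.2 * (FreeGroup.of p.1)⁻¹ * (FreeGroup.of p.2)⁻¹).subset ?_
    rintro _ ⟨i, j, -, a, b, rfl⟩
    exact ⟨(⟨i, a⟩, ⟨j, b⟩), rfl⟩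
  surjective := eval_surjective fun i => (h i).surjective
  ker_eq := ker_eval fun i => (h i).ker_eq

/-- The alphabet `B` is left general so that signed letters and positive letters are treated at
once. -/
theorem exists_area_le {B : V → Type*} {ι : ∀ i, B i → FreeGroup (A i)}
    (hι : ∀ i (b : B i), ∃ a, ι i b = FreeGroup.of a ∨ ι i b = (FreeGroup.of a)⁻¹)
    (hR : ∀ i, (FreeGroup.lift (x i)).ker = Subgroup.normalClosure (R i)) {f : ℕ → ℝ}
    (hf : ∀ i (k : List (B i)), PresentedGroup.mk (R i) (spell ι k) = 1 →
      ∃ m : ℕ, (m : ℝ) ≤ f k.length ∧ IsProdOfConjugates (R i) m (spell ι k))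
    (W : List (Σ i, B i))
    (hW : PresentedGroup.mk (graphProductRelators Γ R) (spellAll ι W) = 1) :
    ∃ m : ℕ, (m : ℝ) ≤ maxPartitionSum f W.length + (W.length : ℝ) ^ 2 ∧
      IsProdOfConjugates (graphProductRelators Γ R) m (spellAll ι W) := by
  rw [PresentedGroup.mk_eq_one_iff, ← ker_eval hR, MonoidHom.mem_ker] at hW
  obtain ⟨l, c, hl, hlen, hc, h⟩ := exists_isProdOfConjugates
    (T := fun n m => (m : ℝ) ≤ f n) hι (lift_eq_one_of_mem hR) (fun i k hk => by
      rw [← MonoidHom.mem_ker, hR, ← PresentedGroup.mk_eq_one_iff] at hk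
      exact hf i k hk) W hW
  refine ⟨_, ?_, h⟩
  rw [Nat.cast_add, ← hlen]
  refine add_le_add (sum_le_maxPartitionSum f l hl) ?_
  rw [hlen]
  exact_mod_cast hc

theorem isIsoperimetricFunction
    (hR : ∀ i, (FreeGroup.lift (x i)).ker = Subgroup.normalClosure (R i)) {f : ℕ → ℝ}
    (hf : ∀ i, IsIsoperimetricFunction (R i) f) :
    IsIsoperimetricFunction (graphProductRelators Γ R)
      (fun n => maxPartitionSum f n + (n : ℝ) ^ 2) := by
  intro W hW
  rw [← spellAll_mk] at hW ⊢
  simpa using exists_area_le (fun i b => ⟨b.1, FreeGroup.mk_singleton_eq b⟩) hR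
    (fun i k hk => by rw [spell_mk] at hk ⊢; exact hf i k hk) _ hW

theorem isPositiveIsoperimetricFunction
    (hR : ∀ i, (FreeGroup.lift (x i)).ker = Subgroup.normalClosure (R i)) {f : ℕ → ℝ}
    (hf : ∀ i, IsPositiveIsoperimetricFunction (R i) f) :
    IsPositiveIsoperimetricFunction (graphProductRelators Γ R)
      (fun n => maxPartitionSum f n + (n : ℝ) ^ 2) := by
  intro W hW
  rw [← spellAll_of] at hW ⊢
  exact exists_area_le (fun i b => ⟨b, .inl rfl⟩) hR (fun i k hk => hf i k hk) _ hW

end GraphProduct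

/-! ### Change of generators along a bijection, and comparison of bounds -/

section Reindex

variable {α β H : Type*} [Group H] {R : Set (FreeGroup α)}

lemma IsFinitePresentation.reindex {x : α → H} (h : IsFinitePresentation x R) (e : α ≃ β) :
    IsFinitePresentation (x ∘ e.symm) (FreeGroup.map e '' R) := by
  have hmap : (FreeGroup.lift (x ∘ e.symm)).comp (FreeGroup.map e) = FreeGroup.lift x := by
    ext a
    simp
  have hsurj : Function.Surjective (FreeGroup.map e) :=
    (FreeGroup.freeGroupCongr e).surjective
  refine ⟨have := h.finite_generators; .of_equiv α e, h.finite_relators.image _, ?_, ?_⟩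
  · have := h.surjective
    rw [← hmap] at this
    exact .of_comp this
  · rw [← Subgroup.map_normalClosure R _ hsurj, ← h.ker_eq, ← hmap, ← MonoidHom.comap_ker,
      Subgroup.map_comap_eq_self_of_surjective hsurj]

lemma IsIsoperimetricFunction.reindex {f : ℕ → ℝ} (h : IsIsoperimetricFunction R f) (e : α ≃ β) :
    IsIsoperimetricFunction (FreeGroup.map e '' R) f := by
  intro w hw
  have hw' : FreeGroup.mk w = FreeGroup.map e (FreeGroup.mk (w.map fun b => (e.symm b.1, b.2))) := by
    simp [FreeGroup.map.mk, Function.comp_def]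
  rw [hw', PresentedGroup.mk_eq_one_iff, ← Subgroup.map_normalClosure R _
    (FreeGroup.freeGroupCongr e).surjective,
    Subgroup.mem_map_iff_mem (FreeGroup.freeGroupCongr e).injective,
    ← PresentedGroup.mk_eq_one_iff] at hw
  obtain ⟨m, hm, hprod⟩ := h _ hw
  rw [hw']
  exact ⟨m, by simpa using hm, hprod.map _ fun r hr => ⟨r, hr, rfl⟩⟩

lemma IsIsoperimetricFunction.mono {f g : ℕ → ℝ} (h : IsIsoperimetricFunction R f)
    (hfg : ∀ n, f n ≤ g n) : IsIsoperimetricFunction R g := fun w hw =>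
  let ⟨m, hm, hprod⟩ := h w hw
  ⟨m, hm.trans (hfg _), hprod⟩

/-- The empty word has area 0, so only nonnegativity matters at 0. This allows p(n) to be replaced
by C nᵏ even if p(0) > 0. -/
lemma IsIsoperimetricFunction.mono_of_pos {f g : ℕ → ℝ} (h : IsIsoperimetricFunction R f)
    (h0 : 0 ≤ g 0) (hfg : ∀ n, 0 < n → f n ≤ g n) : IsIsoperimetricFunction R g := by
  intro w hw
  rcases w with _ | ⟨b, w⟩
  · exact ⟨0, by simpa using h0, .one⟩
  · obtain ⟨m, hm, hprod⟩ := h _ hw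
    exact ⟨m, hm.trans (hfg _ (by simp)), hprod⟩

end Reindex

/-! ### Growth estimates and the main theorem -/

lemma Polynomial.exists_eval_natCast_le (p : Polynomial ℝ) {k : ℕ} (hp : p.degree = k) :
    ∃ C : ℝ, 0 ≤ C ∧ ∀ n : ℕ, 0 < n → p.eval (n : ℝ) ≤ C * (n : ℝ) ^ k := by
  refine ⟨∑ i ∈ Finset.range (k + 1), |p.coeff i|, by positivity, fun n hn => ?_⟩
  rw [Polynomial.eval_eq_sum_range, Polynomial.natDegree_eq_of_degree_eq_some hp, Finset.sum_mul]
  refine Finset.sum_le_sum fun i hi => ?_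
  have hn1 : (1 : ℝ) ≤ n := by exact_mod_cast hn
  calc p.coeff i * (n : ℝ) ^ i ≤ |p.coeff i| * (n : ℝ) ^ i := by gcongr; exact le_abs_self _
    _ ≤ |p.coeff i| * (n : ℝ) ^ k := by
      gcongr
      exact Nat.lt_succ_iff.1 (Finset.mem_range.1 hi)

/-- `n ↦ C * n ^ k` is superadditive for `k > 0`. -/
lemma sum_map_mul_pow_le {C : ℝ} (hC : 0 ≤ C) {k : ℕ} (hk : k ≠ 0) (l : List ℕ) :
    (l.map fun n : ℕ => C * (n : ℝ) ^ k).sum ≤ C * (l.sum : ℝ) ^ k := by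
  induction l with
  | nil => simp [hk]
  | cons n l ih =>
    rw [List.map_cons, List.sum_cons, List.sum_cons]
    push_cast at ih ⊢
    have : (n : ℝ) ^ k + ((l.map (Nat.cast : ℕ → ℝ)).sum) ^ k ≤
        (n + (l.map (Nat.cast : ℕ → ℝ)).sum) ^ k :=
      pow_add_pow_le (by positivity) (List.sum_nonneg (by simp)) hk
    nlinarith

/-- There are at most n blocks, each contributing at most C bⁿ; for b near 1 superadditivity itself
may fail. -/
lemma sum_map_mul_exp_le {C b : ℝ} (hC : 0 ≤ C) (hb : 1 ≤ b) {n : ℕ} (c : Composition n) :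
    (c.blocks.map fun n : ℕ => C * b ^ n).sum ≤ n * (C * b ^ n) := by
  have h1 : (c.blocks.map fun n : ℕ => C * b ^ n).sum ≤ c.blocks.length • (C * b ^ n) := by
    rw [← List.length_map (f := fun n : ℕ => C * b ^ n)]
    refine List.sum_le_card_nsmul _ _ fun y hy => ?_
    obtain ⟨i, hi, rfl⟩ := List.mem_map.1 hy
    gcongr
    exact (List.single_le_sum (by simp) i hi).trans c.blocks_sum.le
  refine h1.trans ?_
  rw [nsmul_eq_mul]
  gcongr
  exact c.length_le

/-- Given a common isoperimetric function `f` of presentations of the vertex groups, a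
presentation of the graph product on a set `Fin m`. -/
lemma GraphProduct.exists_presentation {V : Type*} [Finite V] (Γ : SimpleGraph V) (G : V → Type*)
    [∀ i, Group (G i)] {N : V → ℕ} {x : ∀ i, Fin (N i) → G i} {R : ∀ i, Set (FreeGroup (Fin (N i)))}
    (h : ∀ i, IsFinitePresentation (x i) (R i)) {f : ℕ → ℝ}
    (hf : ∀ i, IsIsoperimetricFunction (R i) f) :
    ∃ (m : ℕ) (y : Fin m → GraphProduct Γ G) (S : Set (FreeGroup (Fin m))),
      IsFinitePresentation y S ∧
        IsIsoperimetricFunction S (fun n => maxPartitionSum f n + (n : ℝ) ^ 2) :=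
  ⟨_, _, _, (isFinitePresentation (Γ := Γ) h).reindex (Finite.equivFin _),
    (isIsoperimetricFunction (fun i => (h i).ker_eq) hf).reindex _⟩

theorem HasPolynomialIsoperimetricFunction.graphProduct {V : Type*} [Finite V] (Γ : SimpleGraph V)
    {G : V → Type*} [∀ i, Group (G i)] {k : ℕ} (hk : 1 < k)
    (h : ∀ i, HasPolynomialIsoperimetricFunction k (G i)) :
    HasPolynomialIsoperimetricFunction k (GraphProduct Γ G) := by
  have := Fintype.ofFinite V
  choose N x R hxR p hp hf using h
  choose C hC hpC using fun i => (p i).exists_eval_natCast_le (hp i)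
  have hk0 : k ≠ 0 := by omega
  have hsum : 0 ≤ ∑ i, C i := Finset.sum_nonneg fun i _ => hC i
  have hf' : ∀ i, IsIsoperimetricFunction (R i) fun n => (∑ i, C i) * (n : ℝ) ^ k := by
    refine fun i => (hf i).mono_of_pos (by simp [hk0]) fun n hn => (hpC i n hn).trans ?_
    gcongr
    exact Finset.single_le_sum (fun j _ => hC j) (Finset.mem_univ i)
  obtain ⟨m, y, S, hyS, hS⟩ := GraphProduct.exists_presentation Γ G hxR hf'
  have hne : ∑ i, C i + 1 ≠ 0 := by positivity
  -- The extra 1 pays for n² ≤ nᵏ and keeps the leading coefficient nonzero, so the degree is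
  -- exactly k.
  refine ⟨m, y, S, hyS, Polynomial.C (∑ i, C i + 1) * Polynomial.X ^ k,
    Polynomial.degree_C_mul_X_pow _ hne, hS.mono fun n => ?_⟩
  have h1 := maxPartitionSum_le (f := fun n => (∑ i, C i) * (n : ℝ) ^ k) (n := n)
    fun c => (sum_map_mul_pow_le hsum hk0 c.blocks).trans_eq (by rw [c.blocks_sum])
  have h2 : (n : ℝ) ^ 2 ≤ (n : ℝ) ^ k := by
    rcases n.eq_zero_or_pos with rfl | hn
    · simp [hk0]
    · exact pow_le_pow_right₀ (by exact_mod_cast hn) hk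
  simp only [Polynomial.eval_mul, Polynomial.eval_C, Polynomial.eval_pow, Polynomial.eval_X]
  linarith

theorem HasExponentialIsoperimetricFunction.graphProduct {V : Type*} [Finite V]
    (Γ : SimpleGraph V) {G : V → Type*} [∀ i, Group (G i)]
    (h : ∀ i, HasExponentialIsoperimetricFunction (G i)) :
    HasExponentialIsoperimetricFunction (GraphProduct Γ G) := by
  have := Fintype.ofFinite V
  choose N x R hxR C b hC hb hf using h
  have hsum : 0 ≤ ∑ i, C i := Finset.sum_nonneg fun i _ => (hC i).le
  have hb0 : ∀ i, 0 ≤ b i := fun i => zero_le_one.trans (hb i).le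
  have hbsum : 0 ≤ ∑ i, b i := Finset.sum_nonneg fun i _ => hb0 i
  have hf' : ∀ i, IsIsoperimetricFunction (R i) fun n => (∑ i, C i) * (∑ i, b i + 1) ^ n := by
    refine fun i => (hf i).mono fun n => ?_
    have h1 : C i ≤ ∑ i, C i :=
      Finset.single_le_sum (fun j _ => (hC j).le) (Finset.mem_univ i)
    have h2 : b i ≤ ∑ i, b i + 1 :=
      (Finset.single_le_sum (fun j _ => hb0 j) (Finset.mem_univ i)).trans (by simp)
    have h3 := hb0 i
    gcongr
  obtain ⟨m, y, S, hyS, hS⟩ := GraphProduct.exists_presentation Γ G hxR hf'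
  -- The factor 4 in the base absorbs both the factor n and the term n²; the 1 added to the constant
  -- pays for n². Both added 1s also cover an empty vertex set.
  refine ⟨m, y, S, hyS, ∑ i, C i + 1, 4 * (∑ i, b i + 1), by positivity, by linarith,
    hS.mono fun n => ?_⟩
  have h1 := maxPartitionSum_le (f := fun n => (∑ i, C i) * (∑ i, b i + 1) ^ n) (n := n)
    fun c => sum_map_mul_exp_le hsum (by linarith) c
  have h2 : (n : ℝ) ≤ 2 ^ n := by exact_mod_cast n.lt_two_pow_self.le
  have h4 : (2 : ℝ) ^ n * 2 ^ n = 4 ^ n := by rw [← mul_pow]; norm_num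
  have h5 : (n : ℝ) ^ 2 ≤ 4 ^ n := by rw [← h4, sq]; gcongr
  have h6 : (n : ℝ) ≤ 4 ^ n := h2.trans (by gcongr; norm_num)
  have h7 : 1 ≤ (∑ i, b i + 1) ^ n := one_le_pow₀ (by linarith)
  calc _ ≤ (n : ℝ) * ((∑ i, C i) * (∑ i, b i + 1) ^ n) + (n : ℝ) ^ 2 := by gcongr
    _ ≤ 4 ^ n * ((∑ i, C i) * (∑ i, b i + 1) ^ n) + 4 ^ n * (∑ i, b i + 1) ^ n := by
      gcongr
      exact h5.trans (le_mul_of_one_le_right (by positivity) h7)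
    _ = _ := by rw [mul_pow]; ring

theorem mainTheorem1 {V : Type*} [Finite V] (Γ : SimpleGraph V)
    (G : V → Type*) [∀ i, Group (G i)] :
    (∀ k : ℕ, 1 < k → (∀ i, HasPolynomialIsoperimetricFunction k (G i)) →
      HasPolynomialIsoperimetricFunction k (GraphProduct Γ G)) ∧
    ((∀ i, HasExponentialIsoperimetricFunction (G i)) →
      HasExponentialIsoperimetricFunction (GraphProduct Γ G)) ∧
    (∀ (A : V → Type*) (x : ∀ i, A i → G i) (R : ∀ i, Set (FreeGroup (A i))),
      (∀ i, IsFinitePresentation (x i) (R i)) →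
      IsFinitePresentation
        (fun a : Σ i, A i => GraphProduct.of Γ G a.1 (x a.1 a.2)) (graphProductRelators Γ R) ∧
      ∀ f : ℕ → ℝ,
        ((∀ i, IsIsoperimetricFunction (R i) f) →
          IsIsoperimetricFunction (graphProductRelators Γ R)
            (fun n => maxPartitionSum f n + (n : ℝ) ^ 2)) ∧
        ((∀ i, IsPositiveIsoperimetricFunction (R i) f) →
          IsPositiveIsoperimetricFunction (graphProductRelators Γ R)
            (fun n => maxPartitionSum f n + (n : ℝ) ^ 2))) := by
  refine ⟨fun k hk h => .graphProduct Γ hk h, fun h => .graphProduct Γ h,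
    fun A x R h => ⟨GraphProduct.isFinitePresentation h, fun f => ⟨fun hf => ?_, fun hf => ?_⟩⟩⟩
  · exact GraphProduct.isIsoperimetricFunction (fun i => (h i).ker_eq) hf
  · exact GraphProduct.isPositiveIsoperimetricFunction (fun i => (h i).ker_eq) hf
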